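/- Let $n\ge 1$ and consider the root system of type $A_n$: with $\varepsilon_1,\dots,\varepsilon_{n+1}$ the standard basis of $\mathbb R^{n+1}$, the root lattice is $Q=\{\lambda\in\mathbb Z^{n+1}:\sum_i\lambda_i=0\}$, the positive roots are $R^+=\{\varepsilon_i-\varepsilon_j: i<j\}$ and the simple roots are $\alpha_i=\varepsilon_i-\varepsilon_{i+1}$. For $\lambda\in Q$ let $\mathrm{ht}(\lambda)=(\lambda,\rho)$ with $\rho=\tfrac12\sum_{\alpha\in R^+}\alpha$ (equivalently, the sum of the coefficients of $\lambda$ in the basis of simple roots). Let $T$ be the compact torus with character lattice $Q$, let $ds$ be its Haar measure of volume one, and write $e^\lambda$ for the character of $T$ given by $\lambda\in Q$. The $q=0$ Cherednik kernel is $$C(t)=\prod_{\alpha\in R^+}\frac{1-e^{\alpha}}{1-te^{\alpha}},$$ the scalar product is $\langle f,g\rangle_t=\int_T f\,\overline g\,C(t)\,ds$, where $\overline{\phantom{g}}$ is the linear involution with $\overline{e^\lambda}=e^{-\lambda}$, and $c_\lambda(t)=\langle 1,e^\lambda\rangle_t$ is the Fourier coefficient of $C(t)$ at $\lambda$. Here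 $t$ is a complex number with $0<|t|<1$, or else a formal variable; in the latter case one works over $\mathbb Q(t)$, $C(t)$ is expanded as a formal power series in $e^{\alpha_1},\dots,e^{\alpha_n}$, and $\int_T$ means taking the coefficient of $e^0$. A weight $\lambda\in Q$ is called a first layer weight if $\lambda=0$ or its smallest coordinate is $-1$. If $i_1<\dots<i_N$ are the positions of the negative coordinates of such a $\lambda$, its aggregate vector is $\mathbf a_\lambda=(\mathbf a_\lambda(1),\dots,\mathbf a_\lambda(N))$ with $\mathbf a_\lambda(j)=\sum_{k=i_j}^{n+1}\lambda_k$. For an integer vector $\mathbf v=(v_1,\dots,v_N)$ write $(1-t^{\mathbf v})=\prod_{j=1}^N\bigl(1-t^{\min\{0,v_j\}}\bigr)$, which is $1$ if $N=0$. **Theorem.** For every first layer weight $\lambda$, $$c_\lambda(t)=t^{\mathrm{ht}(\lambda)}\,(1-t^{\mathbf a_\lambda}),$$ both for every complex $t$ with $0<|t|<1$ and as an identity in $\mathbb Q(t)$ with $t$ a formal variable. -/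

import Mathlib

open MeasureTheory

/-! ### The root system of type `A_n` -/

/-- The root lattice `Q` of type `A_n`: the integer vectors in `ℝ^{n+1}` orthogonal to
`(1, …, 1)`. Its elements are called weights. -/
def rootLattice (n : ℕ) : AddSubgroup (Fin (n + 1) → ℤ) where
  carrier := {v | ∑ i, v i = 0}
  zero_mem' := by simp
  add_mem' := by
    intro a b ha hb
    simp only [Set.mem_ofPred_eq] at ha hb ⊢
    simp [Finset.sum_add_distrib, ha, hb]
  neg_mem' := by
    intro a ha
    simp only [Set.mem_ofPred_eq] at ha ⊢
    simp [ha]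

/-- The root `ε_i - ε_j` (equal to `0` if `i = j`), as an element of the root lattice. -/
def root {n : ℕ} (i j : Fin (n + 1)) : rootLattice n :=
  ⟨Pi.single i 1 - Pi.single j 1, by
    change ∑ k, (Pi.single i 1 - Pi.single j 1 : Fin (n + 1) → ℤ) k = 0
    simp⟩

/-- The simple root `α_k = ε_k - ε_{k+1}`. -/
def simpleRoot {n : ℕ} (k : Fin n) : rootLattice n := root k.castSucc k.succ

/-- The pairs `i < j`, which index the positive roots `ε_i - ε_j`. -/
def posPairs (n : ℕ) : Finset (Fin (n + 1) × Fin (n + 1)) :=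
  Finset.univ.filter fun p => p.1 < p.2

/-- The coefficients of a weight in the basis of simple roots: the `k`-th one is the partial
sum `v_1 + ⋯ + v_k`. -/
def simpleCoeff {n : ℕ} (v : rootLattice n) (k : Fin n) : ℤ :=
  ∑ i ∈ Finset.Iic k.castSucc, v.1 i

/-- The height of a weight: the sum of its coefficients in the basis of simple roots. -/
def height {n : ℕ} (v : rootLattice n) : ℤ := ∑ k, simpleCoeff v k

/-- The vector `ρ`, half the sum of the positive roots. -/
def rho (n : ℕ) (k : Fin (n + 1)) : ℚ :=
  (1 / 2) * ∑ p ∈ posPairs n, ((root p.1 p.2).1 k : ℚ)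

/-! ### First layer weights and aggregate vectors -/

/-- A weight is a `k`-th layer weight if its smallest coordinate equals `-k`. -/
def IsLayerWeight {n : ℕ} (k : ℕ) (v : rootLattice n) : Prop :=
  IsLeast (Set.range v.1) (-(k : ℤ))

/-- First layer weights; by convention the zero weight is included. -/
def IsFirstLayer {n : ℕ} (v : rootLattice n) : Prop := IsLayerWeight 1 v ∨ v = 0

/-- The positions of the negative coordinates. -/
def negPositions {n : ℕ} (v : rootLattice n) : Finset (Fin (n + 1)) :=
  Finset.univ.filter fun i => v.1 i < 0

/-- The co-length: the number of negative coordinates. -/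
def colength {n : ℕ} (v : rootLattice n) : ℕ := (negPositions v).card

/-- The position `i_j` of the `j`-th negative coordinate, where `i_1 < ⋯ < i_N`. -/
def negPosition {n : ℕ} (v : rootLattice n) (j : Fin (colength v)) : Fin (n + 1) :=
  (negPositions v).orderEmbOfFin rfl j

/-- The aggregate vector: its `j`-th coordinate is the sum of the `v_k` with `k ≥ i_j`. -/
def aggregate {n : ℕ} (v : rootLattice n) (j : Fin (colength v)) : ℤ :=
  ∑ k ∈ Finset.Ici (negPosition v j), v.1 k

/-- The expression `(1 - t^a)` for an integer vector `a`: the product over all coordinates of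
`1 - t^{min {0, a_j}}`. -/
def oneSubPow {K : Type*} [Field K] (t : K) {N : ℕ} (a : Fin N → ℤ) : K :=
  ∏ j, (1 - t ^ min 0 (a j))

noncomputable section

/-! ### The Cherednik kernel on the torus, for complex `t` -/

/-- The normalized Haar measure on the compact torus `T = Hom(Q, ℝ/ℤ)`. A point of `T` is given
by its values on the simple roots, so that `T` is the product of `n` copies of `ℝ/ℤ`. -/
def torusMeasure (n : ℕ) : Measure (UnitAddTorus (Fin n)) :=
  Measure.pi fun _ => AddCircle.haarAddCircle

/-- The character `e^v` of the torus: `e^v(x) = ∏_k exp(2πi c_k x_k)` if `v = ∑_k c_k α_k`. -/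
def torusChar {n : ℕ} (v : rootLattice n) (x : UnitAddTorus (Fin n)) : ℂ :=
  UnitAddTorus.mFourier (simpleCoeff v) x

/-- The Cherednik kernel at `q = 0`: the product over the positive roots `α` of
`(1 - e^α) / (1 - t e^α)`, a function on the torus. -/
def cherednikKernel (n : ℕ) (t : ℂ) (x : UnitAddTorus (Fin n)) : ℂ :=
  ∏ p ∈ posPairs n,
    (1 - torusChar (root p.1 p.2) x) / (1 - t * torusChar (root p.1 p.2) x)

/-- The element `e^v` of the group algebra `K[Q]`. -/
def latticeExp (K : Type*) [Field K] {n : ℕ} (v : rootLattice n) :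
    AddMonoidAlgebra K (rootLattice n) :=
  AddMonoidAlgebra.single v 1

/-- The `K`-linear involution of `K[Q]` that sends `e^v` to `e^{-v}`. -/
def bar {K : Type*} [Field K] {n : ℕ} (f : AddMonoidAlgebra K (rootLattice n)) :
    AddMonoidAlgebra K (rootLattice n) :=
  AddMonoidAlgebra.mapDomain (fun v => -v) f

/-- An element of `ℂ[Q]` as a function on the torus. -/
def toTorusFun {n : ℕ} (f : AddMonoidAlgebra ℂ (rootLattice n)) (x : UnitAddTorus (Fin n)) : ℂ :=
  f.coeff.sum fun v a => a * torusChar v x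

/-- The Cherednik scalar product `⟨f, g⟩_t` at `q = 0`, the integral of `f * bar g * C(t)`. -/
def cherednikPairing {n : ℕ} (t : ℂ) (f g : AddMonoidAlgebra ℂ (rootLattice n)) : ℂ :=
  ∫ x, toTorusFun f x * toTorusFun (bar g) x * cherednikKernel n t x ∂(torusMeasure n)

/-! ### The Cherednik kernel with `t` a formal variable -/

/-- `e^v` as a monomial in the variables `e^{α_1}, …, e^{α_n}`, for a weight `v` whose
coefficients in the basis of simple roots are non-negative. -/
def formalExp {n : ℕ} (v : rootLattice n) : MvPowerSeries (Fin n) (RatFunc ℚ) :=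
  MvPowerSeries.monomial (Finsupp.equivFunOnFinite.symm fun k => (simpleCoeff v k).toNat) 1

/-- The Cherednik kernel at `q = 0` over `ℚ(t)`, expanded as a formal power series in
`e^{α_1}, …, e^{α_n}`. -/
def formalKernel (n : ℕ) : MvPowerSeries (Fin n) (RatFunc ℚ) :=
  ∏ p ∈ posPairs n, (1 - formalExp (root p.1 p.2)) *
    (1 - MvPowerSeries.C RatFunc.X * formalExp (root p.1 p.2))⁻¹

/-- The coefficient of `e^v` in the formal kernel; it is zero unless the coefficients of `v` in
the basis of simple roots are all non-negative. -/
def formalKernelCoeff {n : ℕ} (v : rootLattice n) : RatFunc ℚ :=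
  open Classical in
  if ∀ k, 0 ≤ simpleCoeff v k then
    MvPowerSeries.coeff (Finsupp.equivFunOnFinite.symm fun k => (simpleCoeff v k).toNat)
      (formalKernel n)
  else 0

/-- The Cherednik scalar product on `ℚ(t)[Q]` at `q = 0`, with `t` a formal variable: the
coefficient of `e^0` in the formal expansion of `f * bar g * C(t)`. -/
def formalPairing {n : ℕ} (f g : AddMonoidAlgebra (RatFunc ℚ) (rootLattice n)) : RatFunc ℚ :=
  (f * bar g).coeff.sum fun v a => a * formalKernelCoeff (-v)

end

/-! ### Sanity checks for the definitions above -/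

theorem eq_sum_simpleCoeff {n : ℕ} (v : rootLattice n) :
    v = ∑ k, simpleCoeff v k • simpleRoot k := by
  have hv : ∑ i, v.1 i = 0 := v.2
  apply Subtype.ext
  funext i
  have h1 : (∑ k, simpleCoeff v k • simpleRoot k : rootLattice n).1 i =
      (∑ k : Fin n, if i = k.castSucc then ∑ j ∈ Finset.Iic i, v.1 j else 0) -
      ∑ k : Fin n, if i = k.succ then ∑ j ∈ Finset.Iio i, v.1 j else 0 := by
    rw [← Finset.sum_sub_distrib]
    simp only [AddSubgroup.val_finsetSum, Finset.sum_apply]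
    refine Finset.sum_congr rfl fun k _ => ?_
    have hk : Finset.Iio k.succ = Finset.Iic k.castSucc := by
      ext j
      simp [Fin.lt_def, Fin.le_def]
    by_cases h : i = k.castSucc <;> by_cases h' : i = k.succ <;>
      simp_all [simpleRoot, root, simpleCoeff, Pi.single_apply]
  rw [h1]
  have hlast : (∑ k : Fin n, if i = k.castSucc then ∑ j ∈ Finset.Iic i, v.1 j else 0) =
      ∑ j ∈ Finset.Iic i, v.1 j := by
    refine Fin.lastCases ?_ (fun k => ?_) i
    · have : Finset.Iic (Fin.last n) = Finset.univ := by
        ext j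
        simp [Fin.le_last]
      rw [this, hv]
      simp
    · simp
  have hzero : (∑ k : Fin n, if i = k.succ then ∑ j ∈ Finset.Iio i, v.1 j else 0) =
      ∑ j ∈ Finset.Iio i, v.1 j := by
    refine Fin.cases ?_ (fun k => ?_) i
    · have : Finset.Iio (0 : Fin (n + 1)) = ∅ := by
        ext j
        simp
      simp [this]
    · simp
  rw [hlast, hzero, ← Finset.Iio_insert, Finset.sum_insert (by simp)]
  ring

theorem rho_apply {n : ℕ} (k : Fin (n + 1)) : rho n k = n / 2 - k := by
  have h : ∑ p ∈ posPairs n, ((root p.1 p.2).1 k : ℚ) = ((n - k : ℚ)) - k := by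
    have h1 : ∀ p : Fin (n + 1) × Fin (n + 1), ((root p.1 p.2).1 k : ℚ) =
        (if p.1 = k then 1 else 0) - (if p.2 = k then 1 else 0) := by
      intro p
      simp [root, Pi.single_apply, eq_comm]
    have h2 : ∑ p ∈ posPairs n, (if p.1 = k then (1 : ℚ) else 0) = n - k := by
      rw [posPairs, Finset.sum_filter, Fintype.sum_prod_type, Finset.sum_eq_single k]
      · rw [← Finset.sum_filter]
        simp only [if_true, Finset.sum_const, nsmul_eq_mul, mul_one]
        rw [Finset.filter_lt_eq_Ioi, Fin.card_Ioi]
        have := k.is_lt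
        rw [show n + 1 - 1 - (k : ℕ) = n - k by omega, Nat.cast_sub (by omega)]
      · intro i _ hi
        simp [hi]
      · simp
    have h3 : ∑ p ∈ posPairs n, (if p.2 = k then (1 : ℚ) else 0) = k := by
      rw [posPairs, Finset.sum_filter, Fintype.sum_prod_type_right, Finset.sum_eq_single k]
      · rw [← Finset.sum_filter]
        simp only [if_true, Finset.sum_const, nsmul_eq_mul, mul_one]
        rw [Finset.filter_gt_eq_Iio, Fin.card_Iio]
      · intro i _ hi
        simp [hi]
      · simp
    simp only [h1, Finset.sum_sub_distrib, h2, h3]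
  rw [rho, h]
  ring

theorem height_eq_rho {n : ℕ} (v : rootLattice n) :
    (height v : ℚ) = ∑ k, (v.1 k : ℚ) * rho n k := by
  have key : ∀ k : Fin n, rho n k.castSucc - rho n k.succ = 1 := by
    intro k
    simp [rho_apply]
  have h : ∀ i, (v.1 i : ℚ) = ∑ k : Fin n, (simpleCoeff v k : ℚ) *
      ((if i = k.castSucc then 1 else 0) - (if i = k.succ then 1 else 0)) := by
    intro i
    conv_lhs => rw [eq_sum_simpleCoeff v]
    simp [AddSubgroup.val_finsetSum, simpleRoot, root, Pi.single_apply]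
  simp_rw [h, Finset.sum_mul]
  rw [Finset.sum_comm, height]
  push_cast
  refine Finset.sum_congr rfl fun k _ => ?_
  simp_rw [mul_assoc, ← Finset.mul_sum, sub_mul, Finset.sum_sub_distrib, ite_mul, one_mul,
    zero_mul]
  simp [key]

/-!
Let `c` be the family of coefficients of the Cherednik kernel `C = ∏ (1 - e^α) / (1 - t e^α)`. In
both settings it is characterized by two properties (`IsKernelCoeff`): it is supported in the
cone of non-negative combinations of simple roots, and multiplying it by `∏ (1 - t e^α)` gives the
coefficients of `∏ (1 - e^α)`. For formal `t` both are read off from the definition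
(`isKernelCoeff_formalKernelCoeff`). For complex `t` the second holds because the kernel is a
quotient of continuous functions on the torus, and the support condition follows from it
(`isKernelCoeff_torusCoeff`): dividing by `1 - t e^α` means solving `g v = f v + t g (v - α)`, and
iterating this with a bounded `g` and `|t| < 1` shows that `g` vanishes where all `f (v - k α)` do.

Fix a simple root `α = α_i` and put `z = e^α`. Then `C = D (1 - z) / (1 - t z)`, where `D` is the
product over the positive roots other than `α`, which `s_i` permutes. So `D` is invariant under `s_i`,
and `(1 - t z) C = (t - z) s_i(C)`, that is
`c(v) + c(s_i v + α) = t (c(v - α) + c(s_i v))` (`IsKernelCoeff.reflection_relation`). As `s_i(C)`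
is expanded in a different cone, the identity is proved by multiplying with the denominator of `D`
and cancelling it again; this is allowed because both sides have support bounded below for a
grading in which the roots of `D` have positive degree and `α` has degree zero.

If the coordinates of `v` are at least `-1` and `v_i > v_{i+1}`, the four weights in the relation
all have coordinates at least `-1`, and the other three are lower than `v` in height (except
that `s_i v + α = v` if `v_i = v_{i+1} + 1`). A weight without descents is `0`, where `c` is `1`, or has a
negative first coordinate, where `c` vanishes because the weight is outside the cone. So the
relations determine `c` at all first layer weights (`IsKernelCoeff.eq_coeffFormula`), and it remains
to see that the product formula satisfies them (`coeffFormula_reflection_relation`). The only case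
that is not immediate is `v_{i+1} = -1`: there the powers of `t` match as long as the sum of the
coordinates from position `i` on is at most `0`, and otherwise all four products contain a factor
`1 - t^0` (`exists_negFactor_eq_zero`).
-/

/-! ### Group algebras acting on coefficient functions -/

section Convolution

variable {K G ι : Type*} [Field K] [AddCommGroup G]

/-- The group algebra `K[G]` acting on all functions `G → K` by convolution: `e^u` translates a
function by `u`. If a function is read as the family of coefficients of a formal sum of the `e^v`,
this is multiplication. -/
noncomputable def convAction (K G : Type*) [Field K] [AddCommGroup G] :
    AddMonoidAlgebra K G →ₐ[K] Module.End K (G → K) :=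
  AddMonoidAlgebra.lift K (Module.End K (G → K)) G
    { toFun := fun u => LinearMap.funLeft K K fun v => v - u.toAdd
      map_one' := by ext; simp [LinearMap.funLeft]
      map_mul' := fun u w => by
        refine LinearMap.ext fun f => funext fun v => ?_
        simp [LinearMap.funLeft, sub_sub] }

theorem convAction_single (u : G) (a : K) (f : G → K) (v : G) :
    convAction K G (AddMonoidAlgebra.single u a) f v = a * f (v - u) := by
  simp [convAction, AddMonoidAlgebra.lift_single, LinearMap.funLeft]

theorem convAction_one_sub_single (u : G) (a : K) (f : G → K) (v : G) :
    convAction K G (1 - AddMonoidAlgebra.single u a) f v = f v - a * f (v - u) := by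
  rw [map_sub, map_one]
  simp [convAction_single]

/-- The product of the factors `1 - a e^{r p}` for `p ∈ P`, in the group algebra. -/
noncomputable def factorProd (a : K) (P : Finset ι) (r : ι → G) : AddMonoidAlgebra K G :=
  ∏ p ∈ P, (1 - AddMonoidAlgebra.single (r p) a)

theorem convAction_mul_apply (x y : AddMonoidAlgebra K G) (f : G → K) :
    convAction K G (x * y) f = convAction K G x (convAction K G y f) := by
  rw [map_mul, Module.End.mul_apply]

theorem convAction_comm (x y : AddMonoidAlgebra K G) (f : G → K) :
    convAction K G x (convAction K G y f) = convAction K G y (convAction K G x f) := by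
  rw [← convAction_mul_apply, mul_comm, convAction_mul_apply]

theorem factorProd_insert [DecidableEq ι] {a : K} {P : Finset ι} {r : ι → G} {p : ι}
    (hp : p ∉ P) :
    factorProd a (insert p P) r = factorProd a P r * (1 - AddMonoidAlgebra.single (r p) a) := by
  rw [factorProd, Finset.prod_insert hp, mul_comm, factorProd]

@[simp] theorem convAction_factorProd_empty (a : K) (r : ι → G) (f : G → K) :
    convAction K G (factorProd a ∅ r) f = f := by
  simp [factorProd]

/-- Coefficients at `v` are not affected by factors `1 - a e^{r p}` when no translate `v - r p`
meets the support of `f`. -/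
theorem convAction_factorProd_apply_of_forall_sub {S : Set G} {a : K} {P : Finset ι} {r : ι → G}
    (hS : ∀ p ∈ P, ∀ w ∉ S, w - r p ∉ S) {v : G} (hv : ∀ p ∈ P, v - r p ∉ S)
    {f : G → K} (hf : ∀ w ∉ S, f w = 0) :
    convAction K G (factorProd a P r) f v = f v := by
  classical
  induction P using Finset.induction_on generalizing f with
  | empty => simp
  | insert p P hp ih =>
    rw [factorProd_insert hp, convAction_mul_apply, ih]
    · rw [convAction_one_sub_single, hf _ (hv p (by simp))]
      simp
    · exact fun q hq => hS q (by simp [hq])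
    · exact fun q hq => hv q (by simp [hq])
    · intro w hw
      rw [convAction_one_sub_single, hf w hw, hf _ (hS p (by simp) w hw)]
      simp

/-- Multiplication by a product of factors `1 - a e^u` with `u` of positive degree is injective on
functions whose support is bounded below in degree. -/
theorem eq_zero_of_convAction_factorProd_eq_zero (g : G →+ ℤ) {B : ℤ} {a : K} {P : Finset ι}
    {r : ι → G} (hr : ∀ p ∈ P, 1 ≤ g (r p)) {f : G → K} (hf : ∀ w, g w < B → f w = 0)
    (h : convAction K G (factorProd a P r) f = 0) : f = 0 := by
  classical
  induction P using Finset.induction_on generalizing f with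
  | empty => simpa using h
  | insert p P hp ih =>
    have hrp : 1 ≤ g (r p) := hr p (by simp)
    rw [factorProd_insert hp, convAction_mul_apply] at h
    have h1 : ∀ v, f v = a * f (v - r p) := by
      have := ih (fun q hq => hr q (by simp [hq])) (fun w hw => by
        rw [convAction_one_sub_single, hf w hw, hf _ (by rw [map_sub]; omega)]
        simp) h
      intro v
      have := congrFun this v
      rw [convAction_one_sub_single] at this
      exact sub_eq_zero.1 this
    have h2 : ∀ (N : ℕ) (v : G), g v < B + N → f v = 0 := by
      intro N
      induction N with
      | zero => intro v hv; exact hf v (by simpa using hv)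
      | succ N ihN =>
        intro v hv
        push_cast at hv
        rw [h1, ihN _ (by rw [map_sub]; omega), mul_zero]
    funext v
    exact h2 (g v - B + 1).toNat v (by omega)

/-- If `|a| < 1`, dividing by factors `1 - a e^u` does not enlarge the support of a bounded
function beyond a set `S` that is stable under adding `u`. -/
theorem eq_zero_off_of_convAction_factorProd {𝕜 : Type*} [NormedField 𝕜] {S : Set G} {a : 𝕜}
    (ha : ‖a‖ < 1) {P : Finset ι} {r : ι → G} (hS : ∀ p ∈ P, ∀ w ∉ S, w - r p ∉ S) {f : G → 𝕜}
    (hb : ∃ B, ∀ w, ‖f w‖ ≤ B) (h : ∀ w ∉ S, convAction 𝕜 G (factorProd a P r) f w = 0) :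
    ∀ w ∉ S, f w = 0 := by
  classical
  induction P using Finset.induction_on generalizing f with
  | empty => simpa using h
  | insert p P hp ih =>
    obtain ⟨B, hB⟩ := hb
    rw [factorProd_insert hp] at h
    simp only [convAction_mul_apply] at h
    have h1 : ∀ w ∉ S, f w = a * f (w - r p) := by
      intro w hw
      have := ih (fun q hq => hS q (by simp [hq])) ⟨B + ‖a‖ * B, fun w => by
        rw [convAction_one_sub_single]
        refine (norm_sub_le _ _).trans (add_le_add (hB w) ?_)
        rw [norm_mul]
        exact mul_le_mul_of_nonneg_left (hB _) (norm_nonneg a)⟩ h w hw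
      rw [convAction_one_sub_single] at this
      exact sub_eq_zero.1 this
    have h2 : ∀ (N : ℕ), ∀ w ∉ S, ‖f w‖ ≤ ‖a‖ ^ N * B := by
      intro N
      induction N with
      | zero => intro w _; simpa using hB w
      | succ N ihN =>
        intro w hw
        rw [h1 w hw, norm_mul, pow_succ', mul_assoc]
        exact mul_le_mul_of_nonneg_left (ihN _ (hS p (by simp) w hw)) (norm_nonneg a)
    intro w hw
    have hlim : Filter.Tendsto (fun N : ℕ => ‖a‖ ^ N * B) Filter.atTop (nhds 0) := by
      simpa using (tendsto_pow_atTop_nhds_zero_of_lt_one (norm_nonneg a) ha).mul_const B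
    exact norm_le_zero_iff.1 (ge_of_tendsto' hlim fun N => h2 N w hw)

theorem convAction_factorProd_comp (s : G →+ G) (a : K) (P : Finset ι) (r : ι → G) (f : G → K)
    (v : G) :
    convAction K G (factorProd a P fun p => s (r p)) f (s v) =
      convAction K G (factorProd a P r) (fun w => f (s w)) v := by
  classical
  induction P using Finset.induction_on generalizing f with
  | empty => simp
  | insert p P hp ih =>
    rw [factorProd_insert hp, factorProd_insert hp, convAction_mul_apply, convAction_mul_apply, ih]
    refine congrFun (congrArg _ (funext fun w => ?_)) v
    rw [convAction_one_sub_single, convAction_one_sub_single, map_sub]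

/-- The coefficient function of the constant `1`. -/
noncomputable def deltaZero (K G : Type*) [Field K] [AddCommGroup G] : G → K :=
  Set.indicator {0} fun _ => 1

theorem deltaZero_zero : deltaZero K G 0 = 1 := by simp [deltaZero]

theorem deltaZero_of_ne {v : G} (hv : v ≠ 0) : deltaZero K G v = 0 := by simp [deltaZero, hv]

end Convolution

/-! ### Positive cone and simple reflections of the root lattice -/

section RootLattice

variable {n : ℕ}

theorem simpleCoeff_add (v w : rootLattice n) (k : Fin n) :
    simpleCoeff (v + w) k = simpleCoeff v k + simpleCoeff w k := by
  simp [simpleCoeff, Finset.sum_add_distrib]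

theorem simpleCoeff_neg (v : rootLattice n) (k : Fin n) :
    simpleCoeff (-v) k = -simpleCoeff v k := by
  simp [simpleCoeff]

theorem simpleCoeff_sub (v w : rootLattice n) (k : Fin n) :
    simpleCoeff (v - w) k = simpleCoeff v k - simpleCoeff w k := by
  rw [sub_eq_add_neg, simpleCoeff_add, simpleCoeff_neg, sub_eq_add_neg]

theorem simpleCoeff_zero (k : Fin n) : simpleCoeff (0 : rootLattice n) k = 0 := by
  simp [simpleCoeff]

theorem eq_zero_of_simpleCoeff_eq_zero {v : rootLattice n} (h : ∀ k, simpleCoeff v k = 0) :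
    v = 0 := by
  rw [eq_sum_simpleCoeff v]
  simp [h]

/-- The weights whose coefficients in the basis of simple roots are all non-negative. -/
def positiveCone (n : ℕ) : Set (rootLattice n) := {v | ∀ k, 0 ≤ simpleCoeff v k}

theorem zero_mem_positiveCone : (0 : rootLattice n) ∈ positiveCone n := fun k => by
  rw [simpleCoeff_zero]

theorem root_mem_positiveCone {i j : Fin (n + 1)} (hij : i < j) :
    root i j ∈ positiveCone n := by
  intro k
  have h : simpleCoeff (root i j) k =
      (if i ≤ k.castSucc then 1 else 0) - (if j ≤ k.castSucc then 1 else 0) := by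
    simp [simpleCoeff, root]
  rw [h]
  split_ifs <;> omega

theorem root_ne_zero {i j : Fin (n + 1)} (hij : i < j) : (root i j : rootLattice n) ≠ 0 := by
  intro h
  have := congrFun (congrArg Subtype.val h) i
  simp [root, hij.ne] at this

theorem sub_root_notMem_positiveCone {i j : Fin (n + 1)} (hij : i < j) {w : rootLattice n}
    (hw : w ∉ positiveCone n) : w - root i j ∉ positiveCone n := fun h => hw fun k => by
  have h1 := h k
  have h2 := root_mem_positiveCone hij k
  rw [simpleCoeff_sub] at h1
  omega

theorem sub_root_notMem_of_mem_posPairs {p : Fin (n + 1) × Fin (n + 1)} (hp : p ∈ posPairs n)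
    {w : rootLattice n} (hw : w ∉ positiveCone n) : w - root p.1 p.2 ∉ positiveCone n :=
  sub_root_notMem_positiveCone (Finset.mem_filter.1 hp).2 hw

theorem zero_sub_root_notMem_positiveCone {i j : Fin (n + 1)} (hij : i < j) :
    0 - root i j ∉ positiveCone n := fun h => by
  refine root_ne_zero hij (eq_zero_of_simpleCoeff_eq_zero fun k => ?_)
  have h1 := h k
  have h2 := root_mem_positiveCone hij k
  rw [simpleCoeff_sub, simpleCoeff_zero] at h1
  omega

/-- The simple reflection `s_i`, which exchanges the coordinates `i` and `i + 1`. -/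
def simpleReflection (i : Fin n) : rootLattice n →+ rootLattice n where
  toFun v := ⟨fun k => v.1 (Equiv.swap i.castSucc i.succ k), by
    change ∑ k, v.1 (Equiv.swap i.castSucc i.succ k) = 0
    rw [Equiv.sum_comp (Equiv.swap i.castSucc i.succ) v.1]
    exact v.2⟩
  map_zero' := rfl
  map_add' _ _ := rfl

theorem simpleReflection_apply (i : Fin n) (v : rootLattice n) (k : Fin (n + 1)) :
    (simpleReflection i v).1 k = v.1 (Equiv.swap i.castSucc i.succ k) := rfl

theorem simpleReflection_involutive (i : Fin n) (v : rootLattice n) :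
    simpleReflection i (simpleReflection i v) = v :=
  Subtype.ext (funext fun k => by simp [simpleReflection_apply])

theorem simpleReflection_root (i : Fin n) (p q : Fin (n + 1)) :
    simpleReflection i (root p q) =
      root (Equiv.swap i.castSucc i.succ p) (Equiv.swap i.castSucc i.succ q) := by
  refine Subtype.ext (funext fun k => ?_)
  simp [simpleReflection_apply, root, Pi.single_apply, Equiv.swap_apply_eq_iff]

theorem simpleRoot_apply (i : Fin n) (k : Fin (n + 1)) :
    (simpleRoot i : rootLattice n).1 k =
      (if k = i.castSucc then 1 else 0) - (if k = i.succ then 1 else 0) := by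
  simp [simpleRoot, root, Pi.single_apply]

theorem simpleReflection_simpleRoot (i : Fin n) :
    simpleReflection i (simpleRoot i) = -simpleRoot i := by
  rw [simpleRoot, simpleReflection_root, Equiv.swap_apply_left, Equiv.swap_apply_right]
  exact Subtype.ext (by simp [root])

theorem simpleReflection_eq_sub (i : Fin n) (v : rootLattice n) :
    simpleReflection i v = v - (v.1 i.castSucc - v.1 i.succ) • simpleRoot i := by
  refine Subtype.ext (funext fun k => ?_)
  have hne : i.castSucc ≠ i.succ := Fin.castSucc_lt_succ.ne
  rw [simpleReflection_apply]
  simp only [AddSubgroup.coe_sub, AddSubgroup.coe_zsmul, Pi.sub_apply, Pi.smul_apply,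
    simpleRoot_apply, smul_eq_mul]
  rcases eq_or_ne k i.castSucc with rfl | h1
  · simp [hne]
  rcases eq_or_ne k i.succ with rfl | h2
  · simp [hne.symm]
  · simp [Equiv.swap_apply_of_ne_of_ne h1 h2, h1, h2]

theorem simpleReflection_add_simpleRoot (i : Fin n) (v : rootLattice n) :
    simpleReflection i v + simpleRoot i =
      v - (v.1 i.castSucc - v.1 i.succ - 1) • simpleRoot i := by
  rw [simpleReflection_eq_sub, sub_smul _ (1 : ℤ), one_smul]
  abel

/-- The positive roots other than the simple root `α_i`. They are permuted by `s_i`. -/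
def posPairsErase (i : Fin n) : Finset (Fin (n + 1) × Fin (n + 1)) :=
  (posPairs n).erase (i.castSucc, i.succ)

theorem swap_mem_posPairsErase (i : Fin n) {p : Fin (n + 1) × Fin (n + 1)}
    (hp : p ∈ posPairsErase i) :
    (Equiv.swap i.castSucc i.succ p.1, Equiv.swap i.castSucc i.succ p.2) ∈ posPairsErase i := by
  obtain ⟨p, q⟩ := p
  simp only [posPairsErase, posPairs, Finset.mem_erase, Finset.mem_filter, Finset.mem_univ,
    true_and, ne_eq, Prod.mk.injEq, Equiv.swap_apply_def] at hp ⊢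
  simp only [Fin.ext_iff, Fin.lt_def] at hp ⊢
  split_ifs <;> simp_all <;> omega

/-- The coordinates of a linear form whose values on coordinates `i` and `i + 1` agree; doubling
makes room for the common value `2i + 1`. -/
def reflectionWeight (i : Fin n) (k : Fin (n + 1)) : ℤ :=
  if k = i.castSucc ∨ k = i.succ then 2 * (i : ℤ) + 1 else 2 * (k : ℤ)

/-- A grading of the root lattice, invariant under `s_i`, in which all positive roots except `α_i`
have positive degree. -/
def reflectionDegree (i : Fin n) : rootLattice n →+ ℤ where
  toFun v := -∑ k, v.1 k * reflectionWeight i k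
  map_zero' := by simp
  map_add' v w := by simp [add_mul, Finset.sum_add_distrib, add_comm]

theorem reflectionDegree_root (i : Fin n) (p q : Fin (n + 1)) :
    reflectionDegree i (root p q) = reflectionWeight i q - reflectionWeight i p := by
  change -∑ k, (root p q).1 k * _ = _
  simp [root, sub_mul, Pi.single_apply]

theorem one_le_reflectionDegree_root {i : Fin n} {p : Fin (n + 1) × Fin (n + 1)}
    (hp : p ∈ posPairsErase i) : 1 ≤ reflectionDegree i (root p.1 p.2) := by
  obtain ⟨p, q⟩ := p
  rw [reflectionDegree_root]
  simp only [reflectionWeight, posPairsErase, posPairs, Finset.mem_erase,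
    Finset.mem_filter, Finset.mem_univ, true_and, ne_eq, Prod.mk.injEq, Fin.ext_iff, Fin.lt_def,
    Fin.val_castSucc, Fin.val_succ] at hp ⊢
  split_ifs <;> omega

theorem reflectionDegree_simpleRoot (i k : Fin n) : 0 ≤ reflectionDegree i (simpleRoot k) := by
  rw [simpleRoot, reflectionDegree_root]
  simp only [reflectionWeight, Fin.ext_iff, Fin.val_castSucc, Fin.val_succ]
  split_ifs <;> omega

theorem reflectionDegree_simpleRoot_self (i : Fin n) : reflectionDegree i (simpleRoot i) = 0 := by
  rw [simpleRoot, reflectionDegree_root]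
  simp [reflectionWeight]

theorem reflectionDegree_nonneg (i : Fin n) {v : rootLattice n} (hv : v ∈ positiveCone n) :
    0 ≤ reflectionDegree i v := by
  rw [eq_sum_simpleCoeff v, map_sum]
  refine Finset.sum_nonneg fun k _ => ?_
  rw [map_zsmul, smul_eq_mul]
  exact mul_nonneg (hv k) (reflectionDegree_simpleRoot i k)

theorem reflectionDegree_simpleReflection (i : Fin n) (v : rootLattice n) :
    reflectionDegree i (simpleReflection i v) = reflectionDegree i v := by
  rw [simpleReflection_eq_sub, map_sub, map_zsmul, reflectionDegree_simpleRoot_self]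
  simp

end RootLattice

/-! ### The linear relation on the Fourier coefficients given by a simple reflection -/

section Kernel

variable {K : Type*} [Field K] {n : ℕ}

/-- `∏ (1 - a e^α)` over all positive roots `α`. -/
noncomputable def rootProd (a : K) (P : Finset (Fin (n + 1) × Fin (n + 1))) :
    AddMonoidAlgebra K (rootLattice n) :=
  factorProd a P fun p => root p.1 p.2

/-- The property that characterizes the coefficients `c` of the Cherednik kernel at `q = 0`: they
are supported in the positive cone, and multiplying by the denominator of the kernel gives its
numerator. -/
structure IsKernelCoeff (t : K) (c : rootLattice n → K) : Prop where
  eq_zero_of_notMem : ∀ v ∉ positiveCone n, c v = 0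
  conv_eq : convAction K (rootLattice n) (rootProd t (posPairs n)) c =
    convAction K (rootLattice n) (rootProd 1 (posPairs n)) (deltaZero K (rootLattice n))

theorem deltaZero_of_notMem_positiveCone {v : rootLattice n} (hv : v ∉ positiveCone n) :
    deltaZero K (rootLattice n) v = 0 :=
  deltaZero_of_ne fun h => hv (h ▸ zero_mem_positiveCone)

theorem IsKernelCoeff.apply_zero {t : K} {c : rootLattice n → K} (hc : IsKernelCoeff t c) :
    c 0 = 1 := by
  have key : ∀ (a : K) (f : rootLattice n → K), (∀ v ∉ positiveCone n, f v = 0) →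
      convAction K (rootLattice n) (rootProd a (posPairs n)) f 0 = f 0 := by
    intro a f hf
    refine convAction_factorProd_apply_of_forall_sub (S := positiveCone n) ?_ ?_ hf
    · exact fun p hp w hw => sub_root_notMem_of_mem_posPairs hp hw
    · exact fun p hp => zero_sub_root_notMem_positiveCone (Finset.mem_filter.1 hp).2
  rw [← key t c hc.eq_zero_of_notMem, hc.conv_eq, key, deltaZero_zero]
  exact fun v hv => deltaZero_of_notMem_positiveCone hv

theorem convAction_rootProd_posPairsErase_comp (i : Fin n) (a : K) (f : rootLattice n → K)
    (v : rootLattice n) :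
    convAction K _ (rootProd a (posPairsErase i)) f (simpleReflection i v) =
      convAction K _ (rootProd a (posPairsErase i)) (fun w => f (simpleReflection i w)) v := by
  have h : rootProd a (posPairsErase i) =
      factorProd a (posPairsErase i) fun p => simpleReflection i (root p.1 p.2) := by
    refine Finset.prod_bij'
      (fun p _ => (Equiv.swap i.castSucc i.succ p.1, Equiv.swap i.castSucc i.succ p.2))
      (fun p _ => (Equiv.swap i.castSucc i.succ p.1, Equiv.swap i.castSucc i.succ p.2))
      (fun p hp => swap_mem_posPairsErase i hp) (fun p hp => swap_mem_posPairsErase i hp)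
      ?_ ?_ ?_
    · simp
    · simp
    · intro p _
      simp [simpleReflection_root]
  conv_lhs => rw [h]
  exact convAction_factorProd_comp _ _ _ _ _ _

/-- The kernel `C` is `(1 - z) / (1 - t z)` times a factor invariant under `s_i`, where
`z = e^{α_i}`; hence `(1 - t z) C = (t - z) s_i(C)`. This is that identity on coefficients. -/
theorem IsKernelCoeff.reflection_relation {t : K} {c : rootLattice n → K}
    (hc : IsKernelCoeff t c) (i : Fin n) (v : rootLattice n) :
    c v + c (simpleReflection i v + simpleRoot i) =
      t * (c (v - simpleRoot i) + c (simpleReflection i v)) := by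
  set A := convAction K (rootLattice n) with hA
  set s := simpleReflection i with hs
  set α : rootLattice n := simpleRoot i with hα
  have hfac : ∀ a : K, rootProd a (posPairs n) =
      rootProd a (posPairsErase i) * (1 - AddMonoidAlgebra.single α a) := by
    intro a
    have hmem : (i.castSucc, i.succ) ∈ posPairs n :=
      Finset.mem_filter.2 ⟨Finset.mem_univ _, Fin.castSucc_lt_succ⟩
    rw [rootProd, ← Finset.insert_erase hmem, factorProd_insert (Finset.notMem_erase _ _)]
    rfl
  -- `x = (1 - t z) C`, `M` is the part of the numerator invariant under `s_i`.
  set x := A (1 - AddMonoidAlgebra.single α t) c with hx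
  set M := A (rootProd 1 (posPairsErase i)) (deltaZero K (rootLattice n)) with hM
  have hMs : ∀ w, M (s w) = M w := by
    intro w
    rw [hM, convAction_rootProd_posPairsErase_comp]
    refine congrFun (congrArg _ (funext fun w => ?_)) w
    rcases eq_or_ne w 0 with rfl | hw
    · rw [map_zero]
    · rw [deltaZero_of_ne hw, deltaZero_of_ne]
      intro h
      exact hw (by rw [← simpleReflection_involutive i w, h, map_zero])
  have hψx : ∀ w, A (rootProd t (posPairsErase i)) x w = M w - M (w - α) := by
    intro w
    have h := hc.conv_eq
    rw [hfac, hfac, convAction_mul_apply, convAction_mul_apply,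
      convAction_comm (rootProd 1 _) (1 - _)] at h
    rw [hx, hA, h, convAction_one_sub_single, one_mul, ← hA, ← hM]
  set e := x + A (AddMonoidAlgebra.single α 1) (fun w => x (s w)) with he
  have hψe : A (rootProd t (posPairsErase i)) e = 0 := by
    funext w
    rw [he, map_add, convAction_comm _ (AddMonoidAlgebra.single α 1), Pi.add_apply,
      convAction_single,
      ← convAction_rootProd_posPairsErase_comp, hψx, hψx, ← hs, hMs, map_sub, hs,
      simpleReflection_simpleRoot, ← hs, sub_neg_eq_add, add_sub_cancel_right, hMs]
    simp
  have hcdeg : ∀ w, reflectionDegree i w < 0 → c w = 0 := fun w hw =>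
    hc.eq_zero_of_notMem w fun h => (reflectionDegree_nonneg i h).not_gt hw
  have hxdeg : ∀ w, reflectionDegree i w < 0 → x w = 0 := by
    intro w hw
    rw [hx, convAction_one_sub_single, hcdeg w hw, hcdeg]
    · simp
    · rwa [map_sub, reflectionDegree_simpleRoot_self, sub_zero]
  have hezero : e = 0 := by
    refine eq_zero_of_convAction_factorProd_eq_zero (reflectionDegree i) (B := 0)
      (fun p hp => one_le_reflectionDegree_root hp) (fun w hw => ?_) hψe
    rw [he, Pi.add_apply, convAction_single, hxdeg w hw, hxdeg]
    · simp
    · rwa [reflectionDegree_simpleReflection, map_sub, reflectionDegree_simpleRoot_self, sub_zero]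
  have h := congrFun hezero v
  rw [he, Pi.add_apply, convAction_single, hx, convAction_one_sub_single,
    convAction_one_sub_single, map_sub, hs, simpleReflection_simpleRoot, ← hs, sub_neg_eq_add,
    add_sub_cancel_right, Pi.zero_apply] at h
  linear_combination h

end Kernel

/-! ### The product formula -/

section Formula

variable {K : Type*} [Field K] {n : ℕ}

/-- The sum of the coordinates of a weight from position `p` on. -/
def tailSum (v : rootLattice n) (p : Fin (n + 1)) : ℤ := ∑ k ∈ Finset.Ici p, v.1 k

/-- The factor that position `p` contributes to `(1 - t^{a_v})`. -/
def negFactor (t : K) (v : rootLattice n) (p : Fin (n + 1)) : K :=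
  if v.1 p < 0 then 1 - t ^ min 0 (tailSum v p) else 1

/-- The right-hand side of the formula for the Fourier coefficients, with the product over the
coordinates of the aggregate vector written as a product over all positions. -/
def coeffFormula (t : K) (v : rootLattice n) : K := t ^ height v * ∏ p, negFactor t v p

theorem oneSubPow_aggregate (t : K) (v : rootLattice n) :
    oneSubPow t (aggregate v) = ∏ p, negFactor t v p := by
  simp only [negFactor]
  rw [← Finset.prod_filter, oneSubPow]
  change ∏ j : Fin (colength v), (1 - t ^ min 0 (tailSum v (negPosition v j))) =
    ∏ p ∈ negPositions v, (1 - t ^ min 0 (tailSum v p))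
  rw [← Finset.prod_coe_sort (negPositions v) fun p => 1 - t ^ min 0 (tailSum v p)]
  exact Fintype.prod_equiv ((negPositions v).orderIsoOfFin rfl).toEquiv _ _ fun j => rfl

theorem tailSum_zero (v : rootLattice n) : tailSum v 0 = 0 := by
  have h : Finset.Ici (0 : Fin (n + 1)) = Finset.univ := by ext; simp
  rw [tailSum, h]
  exact v.2

theorem tailSum_castSucc (v : rootLattice n) (i : Fin n) :
    tailSum v i.castSucc = v.1 i.castSucc + tailSum v i.succ := by
  have h : Finset.Ici i.castSucc = insert i.castSucc (Finset.Ici i.succ) := by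
    ext k
    simp only [Finset.mem_Ici, Finset.mem_insert, Fin.le_def, Fin.ext_iff, Fin.val_castSucc,
      Fin.val_succ]
    omega
  rw [tailSum, tailSum, h, Finset.sum_insert (by simp [Fin.le_def])]

theorem tailSum_sub_zsmul (v : rootLattice n) (c : ℤ) (i : Fin n) (p : Fin (n + 1)) :
    tailSum (v - c • simpleRoot i) p = tailSum v p + if p = i.succ then c else 0 := by
  simp only [tailSum, AddSubgroup.coe_sub, AddSubgroup.coe_zsmul, Pi.sub_apply, Pi.smul_apply,
    simpleRoot_apply, smul_eq_mul, Finset.sum_sub_distrib, ← Finset.mul_sum,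
    Finset.sum_ite_eq', Finset.mem_Ici]
  simp only [Fin.le_def, Fin.ext_iff, Fin.val_castSucc, Fin.val_succ]
  split_ifs <;> omega

theorem height_sub_zsmul (v : rootLattice n) (c : ℤ) (i : Fin n) :
    height (v - c • simpleRoot i) = height v - c := by
  have h1 : ∀ k, simpleCoeff (v - c • simpleRoot i) k =
      simpleCoeff v k - if k = i then c else 0 := by
    intro k
    simp only [simpleCoeff, AddSubgroup.coe_sub, AddSubgroup.coe_zsmul, Pi.sub_apply,
      Pi.smul_apply, simpleRoot_apply, smul_eq_mul, Finset.sum_sub_distrib, ← Finset.mul_sum,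
      Finset.sum_ite_eq', Finset.mem_Iic]
    simp only [Fin.le_def, Fin.ext_iff, Fin.val_castSucc, Fin.val_succ]
    split_ifs <;> omega
  simp only [height, h1, Finset.sum_sub_distrib, Finset.sum_ite_eq', Finset.mem_univ, if_true]

/-- If some tail sum is positive, one of the earlier factors is `1 - t ^ 0`: tail sums start at `0`
and, read from left to right, increase by at most one at a time, so the first positive one follows
a coordinate `-1` whose tail sum is `0`. -/
theorem exists_negFactor_eq_zero (t : K) {v : rootLattice n} (hv : ∀ k, -1 ≤ v.1 k)
    {p : Fin (n + 1)} (hp : 0 < tailSum v p) : ∃ q < p, negFactor t v q = 0 := by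
  induction p using Fin.induction with
  | zero => rw [tailSum_zero] at hp; omega
  | succ i ih =>
    rcases lt_or_ge 0 (tailSum v i.castSucc) with h | h
    · obtain ⟨q, hq, h0⟩ := ih h
      exact ⟨q, hq.trans Fin.castSucc_lt_succ, h0⟩
    · have h1 := tailSum_castSucc v i
      have h2 := hv i.castSucc
      have h3 : tailSum v i.castSucc = 0 := by omega
      refine ⟨i.castSucc, Fin.castSucc_lt_succ, ?_⟩
      rw [negFactor, if_pos (by omega), h3]
      simp

theorem coeffFormula_of_neg (t : K) {v : rootLattice n} (h : v.1 0 < 0) :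
    coeffFormula t v = 0 := by
  rw [coeffFormula, Finset.prod_eq_zero (Finset.mem_univ 0), mul_zero]
  rw [negFactor, if_pos h, tailSum_zero]
  simp

/-- The formula along the string `v - c α_i`: only the height and the two factors at positions `i`
and `i + 1` depend on `c`. -/
theorem coeffFormula_sub_zsmul (t : K) (v : rootLattice n) (i : Fin n) (c : ℤ) :
    coeffFormula t (v - c • simpleRoot i) = t ^ (height v - c) *
      ((if v.1 i.castSucc - c < 0 then 1 - t ^ min 0 (tailSum v i.castSucc) else 1) *
       (if v.1 i.succ + c < 0 then 1 - t ^ min 0 (tailSum v i.succ + c) else 1) *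
       ∏ p ∈ (Finset.univ.erase i.castSucc).erase i.succ, negFactor t v p) := by
  have hne : i.castSucc ≠ i.succ := Fin.castSucc_lt_succ.ne
  have hmem : i.succ ∈ Finset.univ.erase i.castSucc := by simp [hne.symm]
  rw [coeffFormula, height_sub_zsmul, ← Finset.mul_prod_erase _ _ (Finset.mem_univ i.castSucc),
    ← Finset.mul_prod_erase _ _ hmem, ← mul_assoc (negFactor _ _ _)]
  have hcoord : ∀ k, (v - c • simpleRoot i).1 k =
      v.1 k - c * ((if k = i.castSucc then 1 else 0) - (if k = i.succ then 1 else 0)) := by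
    intro k
    simp only [AddSubgroup.coe_sub, AddSubgroup.coe_zsmul, Pi.sub_apply, Pi.smul_apply,
      simpleRoot_apply, smul_eq_mul]
  congr 2
  · simp only [negFactor, hcoord, tailSum_sub_zsmul]
    simp [hne, hne.symm]
  · refine Finset.prod_congr rfl fun p hp => ?_
    simp only [Finset.mem_erase, Finset.mem_univ, and_true] at hp
    simp only [negFactor, hcoord, tailSum_sub_zsmul]
    simp [hp.1, hp.2]

/-- The product formula satisfies the relation of `IsKernelCoeff.reflection_relation` at every
descent of a weight with coordinates at least `-1`. -/
theorem coeffFormula_reflection_relation {t : K} (ht : t ≠ 0) {v : rootLattice n}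
    (hv : ∀ k, -1 ≤ v.1 k) {i : Fin n} (hi : v.1 i.succ < v.1 i.castSucc) :
    coeffFormula t v + coeffFormula t (simpleReflection i v + simpleRoot i) =
      t * (coeffFormula t (v - simpleRoot i) + coeffFormula t (simpleReflection i v)) := by
  have h0 : v = v - (0 : ℤ) • simpleRoot i := by simp
  have h1 : v - simpleRoot i = v - (1 : ℤ) • simpleRoot i := by simp
  rw [h1, simpleReflection_add_simpleRoot, simpleReflection_eq_sub]
  conv_lhs => enter [1]; rw [h0]
  simp only [coeffFormula_sub_zsmul]
  have hT := tailSum_castSucc v i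
  have ha := hv i.castSucc
  have hb := hv i.succ
  have hR : 0 < tailSum v i.castSucc →
      ∏ p ∈ (Finset.univ.erase i.castSucc).erase i.succ, negFactor t v p = 0 := by
    intro h
    obtain ⟨q, hq, hq0⟩ := exists_negFactor_eq_zero t hv h
    have hq' : q ≠ i.succ := (hq.trans Fin.castSucc_lt_succ).ne
    exact Finset.prod_eq_zero (by simp [hq.ne, hq']) hq0
  generalize ∏ p ∈ (Finset.univ.erase i.castSucc).erase i.succ, negFactor t v p = R at hR ⊢
  generalize tailSum v i.castSucc = S at *
  generalize tailSum v i.succ = T at *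
  generalize v.1 i.castSucc = a at *
  generalize v.1 i.succ = b at *
  generalize height v = h
  have hpow : ∀ k l : ℤ, k = l + 1 → t ^ k = t * t ^ l := by
    rintro k l rfl
    rw [zpow_add_one₀ ht, mul_comm]
  rcases lt_or_ge 0 S with hS | hS
  · simp [hR hS]
  rcases lt_or_ge b 0 with hb0 | hb0
  · obtain rfl : b = -1 := by omega
    rcases eq_or_ne a 0 with rfl | ha0
    · obtain rfl : S = T := by omega
      simp [hpow h (h - 1) (by ring)]
      ring
    · rw [if_neg (by omega), if_pos (by omega), if_neg (by omega), if_neg (by omega),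
        if_neg (by omega), if_neg (by omega), if_pos (by omega), if_neg (by omega),
        min_eq_right hS, min_eq_right (by omega), hT]
      have e1 := hpow (h - 0) (h - 1) (by ring)
      have e2 := hpow (h - (a - -1 - 1)) (h - (a - -1)) (by ring)
      have e3 : t ^ (h - 0) * t ^ (T + 0) = t * (t ^ (h - (a - -1)) * t ^ (a + T)) := by
        rw [← zpow_add₀ ht, ← zpow_add₀ ht, ← hpow _ _ rfl]
        congr 1
        ring
      linear_combination R * (e1 + e2 - e3)
  · rw [if_neg (by omega), if_neg (by omega), if_neg (by omega), if_neg (by omega),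
      if_neg (by omega), if_neg (by omega), if_neg (by omega), if_neg (by omega)]
    have e1 := hpow (h - 0) (h - 1) (by ring)
    have e2 := hpow (h - (a - b - 1)) (h - (a - b)) (by ring)
    linear_combination R * (e1 + e2)

theorem le_height {v : rootLattice n} (hv : ∀ k, -1 ≤ v.1 k) :
    -((n : ℤ) * (n + 1)) ≤ height v := by
  have h : ∀ k ∈ (Finset.univ : Finset (Fin n)), -((n : ℤ) + 1) ≤ simpleCoeff v k := by
    intro k _
    have h1 := Finset.card_nsmul_le_sum (Finset.Iic k.castSucc) v.1 (-1) fun j _ => hv j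
    have h2 : (Finset.Iic k.castSucc).card ≤ n + 1 := by simp
    simp only [nsmul_eq_mul] at h1
    rw [simpleCoeff]
    refine le_trans ?_ h1
    have h3 : ((Finset.Iic k.castSucc).card : ℤ) ≤ n + 1 := by exact_mod_cast h2
    linarith
  have := Finset.card_nsmul_le_sum _ _ _ h
  simp only [Finset.card_univ, Fintype.card_fin, nsmul_eq_mul] at this
  rw [height]
  linarith

/-- A weight without descents is zero or has a negative first coordinate. -/
theorem eq_zero_or_neg_of_monotone {v : rootLattice n} (hv : Monotone v.1) :
    v = 0 ∨ v.1 0 < 0 := by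
  rcases lt_or_ge (v.1 0) 0 with h | h
  · exact Or.inr h
  · left
    have h1 : ∀ k, 0 ≤ v.1 k := fun k => h.trans (hv (Fin.zero_le k))
    have h2 := (Finset.sum_eq_zero_iff_of_nonneg fun k _ => h1 k).1 (show ∑ k, v.1 k = 0 from v.2)
    exact Subtype.ext (funext fun k => h2 k (Finset.mem_univ k))

/-- The relations given by the simple reflections determine the coefficients at weights with
coordinates at least `-1`, by induction on the height: at a descent `i`, the other three weights in
the relation are lower, except that `s_i v + α_i = v` for a descent by one. -/
theorem IsKernelCoeff.eq_coeffFormula [CharZero K] {t : K} (ht : t ≠ 0) {c : rootLattice n → K}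
    (hc : IsKernelCoeff t c) {v : rootLattice n} (hv : ∀ k, -1 ≤ v.1 k) :
    c v = coeffFormula t v := by
  have key : ∀ (N : ℕ) (v : rootLattice n), (∀ k, -1 ≤ v.1 k) →
      height v + n * (n + 1) < N → c v = coeffFormula t v := by
    intro N
    induction N with
    | zero =>
      intro v hv h
      have := le_height hv
      push_cast at h
      linarith
    | succ N ih =>
      intro v hv hN
      by_cases hmono : Monotone v.1
      · rcases eq_zero_or_neg_of_monotone hmono with rfl | h
        · rw [hc.apply_zero]
          simp [coeffFormula, negFactor, height, simpleCoeff_zero]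
        · rw [coeffFormula_of_neg t h]
          refine hc.eq_zero_of_notMem v fun hmem => ?_
          -- For `n = 0` the only weight is `0`, so there is a first simple root.
          have h0 : 0 < n := by
            by_contra h0
            obtain rfl : n = 0 := by omega
            have := v.2
            change ∑ k, v.1 k = 0 at this
            simp at this
            omega
          have h1 := hmem ⟨0, h0⟩
          have h2 : Finset.Iic (⟨0, h0⟩ : Fin n).castSucc = {0} := by
            exact Finset.Iic_bot
          rw [simpleCoeff, h2, Finset.sum_singleton] at h1
          omega
      · rw [Fin.monotone_iff_le_succ] at hmono
        push Not at hmono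
        obtain ⟨i, hi⟩ := hmono
        have hlow : ∀ m : ℤ, 0 < m → m ≤ v.1 i.castSucc - v.1 i.succ →
            c (v - m • simpleRoot i) = coeffFormula t (v - m • simpleRoot i) := by
          intro m hm0 hm
          refine ih _ (fun k => ?_) ?_
          · have hk := hv k
            have ha := hv i.castSucc
            have hb := hv i.succ
            simp only [AddSubgroup.coe_sub, AddSubgroup.coe_zsmul, Pi.sub_apply, Pi.smul_apply,
              simpleRoot_apply, smul_eq_mul]
            split_ifs with h1 h2 h2 <;> subst_vars <;> omega
          · rw [height_sub_zsmul]
            push_cast at hN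
            linarith
        have r1 := hc.reflection_relation i v
        have r2 := coeffFormula_reflection_relation ht hv hi
        have e1 := hlow 1 one_pos (by omega)
        have e2 := hlow (v.1 i.castSucc - v.1 i.succ) (by omega) le_rfl
        rw [one_smul] at e1
        rw [← simpleReflection_eq_sub] at e2
        rw [e1, e2, ← r2, simpleReflection_add_simpleRoot] at r1
        rcases eq_or_ne (v.1 i.castSucc - v.1 i.succ) 1 with hm | hm
        · rw [hm, sub_self, zero_smul, sub_zero, ← two_mul, ← two_mul] at r1
          exact mul_left_cancel₀ two_ne_zero r1
        · rw [hlow _ (by omega) (by omega)] at r1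
          exact add_right_cancel r1
  exact key (height v + n * (n + 1) + 1).toNat v hv (by have := le_height hv; omega)

theorem IsFirstLayer.neg_one_le {v : rootLattice n} (hv : IsFirstLayer v) (k : Fin (n + 1)) :
    -1 ≤ v.1 k := by
  rcases hv with h | rfl
  · simpa using h.2 (Set.mem_range_self k)
  · simp

end Formula

/-! ### Fourier coefficients on the torus -/

section Torus

variable {n : ℕ}

instance : IsProbabilityMeasure (torusMeasure n) := by
  unfold torusMeasure
  infer_instance

theorem torusChar_add (u v : rootLattice n) (x : UnitAddTorus (Fin n)) :
    torusChar (u + v) x = torusChar u x * torusChar v x := by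
  rw [torusChar, show simpleCoeff (u + v) = simpleCoeff u + simpleCoeff v from
    funext (simpleCoeff_add u v), UnitAddTorus.mFourier_add]
  rfl

theorem torusChar_zero (x : UnitAddTorus (Fin n)) : torusChar 0 x = 1 := by
  rw [torusChar, show simpleCoeff (0 : rootLattice n) = 0 from funext simpleCoeff_zero,
    UnitAddTorus.mFourier_zero]
  rfl

theorem norm_torusChar (v : rootLattice n) (x : UnitAddTorus (Fin n)) : ‖torusChar v x‖ = 1 := by
  simp only [torusChar, UnitAddTorus.mFourier, ContinuousMap.coe_mk, norm_prod, fourier_apply,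
    Circle.norm_coe, Finset.prod_const_one]

theorem continuous_torusChar (v : rootLattice n) : Continuous (torusChar v) :=
  (UnitAddTorus.mFourier (simpleCoeff v)).continuous

theorem integrable_torusMeasure {f : UnitAddTorus (Fin n) → ℂ} (hf : Continuous f) :
    Integrable f (torusMeasure n) :=
  hf.integrable_of_hasCompactSupport (HasCompactSupport.of_compactSpace f)

theorem integral_fourier_eq_zero {k : ℤ} (hk : k ≠ 0) :
    ∫ x : AddCircle (1 : ℝ), fourier k x ∂AddCircle.haarAddCircle = 0 :=
  integral_eq_zero_of_add_right_eq_neg (fourier_add_half_inv_index hk Fact.out)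

theorem integral_torusChar {v : rootLattice n} (hv : v ≠ 0) :
    ∫ x, torusChar v x ∂(torusMeasure n) = 0 := by
  obtain ⟨k, hk⟩ : ∃ k, simpleCoeff v k ≠ 0 := by
    by_contra! h
    exact hv (eq_zero_of_simpleCoeff_eq_zero h)
  change ∫ x : Fin n → AddCircle (1 : ℝ), ∏ i, fourier (simpleCoeff v i) (x i)
    ∂(Measure.pi fun _ => AddCircle.haarAddCircle) = 0
  rw [integral_fintype_prod_eq_prod fun (i : Fin n) (y : AddCircle (1 : ℝ)) =>
    (fourier (simpleCoeff v i) y : ℂ)]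
  exact Finset.prod_eq_zero (Finset.mem_univ k) (integral_fourier_eq_zero hk)

/-- The Fourier coefficients of a function on the torus. -/
noncomputable def torusCoeff (f : UnitAddTorus (Fin n) → ℂ) (v : rootLattice n) : ℂ :=
  ∫ x, torusChar (-v) x * f x ∂(torusMeasure n)

theorem norm_torusCoeff_le (f : UnitAddTorus (Fin n) → ℂ) (v : rootLattice n) :
    ‖torusCoeff f v‖ ≤ ∫ x, ‖f x‖ ∂(torusMeasure n) := by
  refine (norm_integral_le_integral_norm _).trans_eq ?_
  simp [norm_torusChar]

theorem torusCoeff_one : torusCoeff (fun _ => 1) = deltaZero ℂ (rootLattice n) := by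
  funext v
  rcases eq_or_ne v 0 with rfl | hv
  · simp [torusCoeff, torusChar_zero, deltaZero_zero]
  · simp [torusCoeff, integral_torusChar (neg_ne_zero.2 hv), deltaZero_of_ne hv]

theorem torusCoeff_one_sub_mul (a : ℂ) (u : rootLattice n) {f : UnitAddTorus (Fin n) → ℂ}
    (hf : Continuous f) (v : rootLattice n) :
    torusCoeff (fun x => (1 - a * torusChar u x) * f x) v =
      torusCoeff f v - a * torusCoeff f (v - u) := by
  rw [torusCoeff, torusCoeff, torusCoeff, ← integral_const_mul, ← integral_sub]
  · refine integral_congr_ae (Filter.Eventually.of_forall fun x => ?_)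
    change torusChar (-v) x * ((1 - a * torusChar u x) * f x) =
      torusChar (-v) x * f x - a * (torusChar (-(v - u)) x * f x)
    rw [show -(v - u) = u + -v by abel, torusChar_add]
    ring
  · exact integrable_torusMeasure ((continuous_torusChar _).mul hf)
  · exact integrable_torusMeasure (continuous_const.mul ((continuous_torusChar _).mul hf))

theorem torusCoeff_prod_mul (a : ℂ) (P : Finset (Fin (n + 1) × Fin (n + 1)))
    {f : UnitAddTorus (Fin n) → ℂ} (hf : Continuous f) :
    torusCoeff (fun x => (∏ p ∈ P, (1 - a * torusChar (root p.1 p.2) x)) * f x) =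
      convAction ℂ _ (rootProd a P) (torusCoeff f) := by
  induction P using Finset.induction_on generalizing f with
  | empty => simp [rootProd]
  | insert p P hp ih =>
    have hc : Continuous fun x => (1 - a * torusChar (root p.1 p.2) x) * f x :=
      (continuous_const.sub (continuous_const.mul (continuous_torusChar _))).mul hf
    rw [rootProd, factorProd_insert hp, convAction_mul_apply]
    have h := ih hc
    simp only [Finset.prod_insert hp]
    rw [show convAction ℂ _ (1 - AddMonoidAlgebra.single (root p.1 p.2) a) (torusCoeff f) =
      torusCoeff fun x => (1 - a * torusChar (root p.1 p.2) x) * f x from funext fun v => by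
        rw [convAction_one_sub_single, torusCoeff_one_sub_mul _ _ hf]]
    rw [← rootProd, ← h]
    congr 1
    funext x
    ring

theorem one_sub_mul_torusChar_ne_zero {t : ℂ} (ht : ‖t‖ < 1) (v : rootLattice n)
    (x : UnitAddTorus (Fin n)) : 1 - t * torusChar v x ≠ 0 := by
  intro h
  have := congrArg norm (sub_eq_zero.1 h)
  rw [norm_mul, norm_torusChar, mul_one, norm_one] at this
  exact ht.ne this.symm

theorem continuous_cherednikKernel {t : ℂ} (ht : ‖t‖ < 1) :
    Continuous (cherednikKernel n t) := by
  refine continuous_finsetProd _ fun p _ => Continuous.div ?_ ?_ ?_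
  · exact continuous_const.sub (continuous_torusChar _)
  · exact continuous_const.sub (continuous_const.mul (continuous_torusChar _))
  · exact fun x => one_sub_mul_torusChar_ne_zero ht _ x

theorem isKernelCoeff_torusCoeff {t : ℂ} (ht : ‖t‖ < 1) :
    IsKernelCoeff t (torusCoeff (cherednikKernel n t)) := by
  have hconv : convAction ℂ (rootLattice n) (rootProd t (posPairs n))
      (torusCoeff (cherednikKernel n t)) =
      convAction ℂ (rootLattice n) (rootProd 1 (posPairs n))
        (deltaZero ℂ (rootLattice n)) := by
    rw [← torusCoeff_one, ← torusCoeff_prod_mul t _ (continuous_cherednikKernel ht),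
      ← torusCoeff_prod_mul 1 _ continuous_const]
    congr 1
    funext x
    rw [cherednikKernel, ← Finset.prod_mul_distrib, mul_one]
    refine Finset.prod_congr rfl fun p _ => ?_
    rw [mul_div_cancel₀ _ (one_sub_mul_torusChar_ne_zero ht _ x), one_mul]
  refine ⟨?_, hconv⟩
  refine eq_zero_off_of_convAction_factorProd ht
    (fun p (hp : p ∈ posPairs n) w hw => sub_root_notMem_of_mem_posPairs hp hw)
    ⟨_, norm_torusCoeff_le _⟩ fun w hw => ?_
  change convAction ℂ _ (rootProd t (posPairs n)) _ w = 0
  rw [hconv, rootProd, convAction_factorProd_apply_of_forall_sub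
    (fun p hp w hw => sub_root_notMem_of_mem_posPairs hp hw)
    (fun p hp => sub_root_notMem_of_mem_posPairs hp hw)
    (fun v hv => deltaZero_of_notMem_positiveCone hv), deltaZero_of_notMem_positiveCone hw]

theorem toTorusFun_single (v : rootLattice n) (a : ℂ) (x : UnitAddTorus (Fin n)) :
    toTorusFun (AddMonoidAlgebra.single v a) x = a * torusChar v x := by
  simp [toTorusFun]

theorem cherednikPairing_one_latticeExp (t : ℂ) (v : rootLattice n) :
    cherednikPairing t 1 (latticeExp ℂ v) = torusCoeff (cherednikKernel n t) v := by
  simp only [cherednikPairing, torusCoeff, bar, latticeExp, AddMonoidAlgebra.mapDomain_single,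
    AddMonoidAlgebra.one_def, toTorusFun_single, torusChar_zero, one_mul]

end Torus

/-! ### Coefficients of the formal kernel -/

section Formal

variable {n : ℕ}

/-- The coefficient of `e^v` in a power series in `e^{α_1}, …, e^{α_n}`; it is zero outside the
positive cone. -/
noncomputable def seriesCoeff (φ : MvPowerSeries (Fin n) (RatFunc ℚ)) (v : rootLattice n) :
    RatFunc ℚ :=
  open Classical in
  if v ∈ positiveCone n then
    MvPowerSeries.coeff (Finsupp.equivFunOnFinite.symm fun k => (simpleCoeff v k).toNat) φ
  else 0

theorem seriesCoeff_of_notMem (φ : MvPowerSeries (Fin n) (RatFunc ℚ)) {v : rootLattice n}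
    (hv : v ∉ positiveCone n) : seriesCoeff φ v = 0 := if_neg hv

theorem seriesCoeff_of_mem (φ : MvPowerSeries (Fin n) (RatFunc ℚ)) {v : rootLattice n}
    (hv : v ∈ positiveCone n) : seriesCoeff φ v =
      MvPowerSeries.coeff (Finsupp.equivFunOnFinite.symm fun k => (simpleCoeff v k).toNat) φ :=
  if_pos hv

theorem seriesCoeff_one : seriesCoeff (n := n) 1 = deltaZero (RatFunc ℚ) (rootLattice n) := by
  classical
  funext v
  by_cases hv : v ∈ positiveCone n
  · rw [seriesCoeff_of_mem _ hv, MvPowerSeries.coeff_one]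
    rcases eq_or_ne v 0 with rfl | hv0
    · rw [deltaZero_zero, if_pos]
      ext k
      simp [simpleCoeff_zero]
    · rw [deltaZero_of_ne hv0, if_neg]
      intro h
      refine hv0 (eq_zero_of_simpleCoeff_eq_zero fun k => ?_)
      have h1 := DFunLike.congr_fun h k
      have h2 := hv k
      simp only [Finsupp.equivFunOnFinite_symm_apply_apply, Finsupp.coe_zero, Pi.zero_apply] at h1
      omega
  · rw [seriesCoeff_of_notMem _ hv, deltaZero_of_notMem_positiveCone hv]

theorem seriesCoeff_one_sub_mul (a : RatFunc ℚ) {i j : Fin (n + 1)} (hij : i < j)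
    (φ : MvPowerSeries (Fin n) (RatFunc ℚ)) (v : rootLattice n) :
    seriesCoeff ((1 - MvPowerSeries.C a * formalExp (root i j)) * φ) v =
      seriesCoeff φ v - a * seriesCoeff φ (v - root i j) := by
  classical
  by_cases hv : v ∈ positiveCone n
  · rw [seriesCoeff_of_mem _ hv, seriesCoeff_of_mem _ hv, sub_mul, one_mul, map_sub, mul_assoc,
      MvPowerSeries.coeff_C_mul, formalExp, MvPowerSeries.coeff_monomial_mul, one_mul]
    congr 2
    have hr := root_mem_positiveCone hij
    by_cases hw : v - root i j ∈ positiveCone n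
    · rw [seriesCoeff_of_mem _ hw, if_pos]
      · congr 2
        ext k
        have h1 := hr k
        have h2 := hw k
        have h3 := hv k
        rw [simpleCoeff_sub] at h2
        simp only [Finsupp.coe_tsub, Pi.sub_apply, Finsupp.equivFunOnFinite_symm_apply_apply,
          simpleCoeff_sub]
        omega
      · intro k
        have h2 := hw k
        rw [simpleCoeff_sub] at h2
        simp only [Finsupp.equivFunOnFinite_symm_apply_apply]
        omega
    · rw [seriesCoeff_of_notMem _ hw, if_neg]
      intro h
      refine hw fun k => ?_
      have h1 := h k
      have h2 := hr k
      have h3 := hv k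
      simp only [Finsupp.equivFunOnFinite_symm_apply_apply] at h1
      rw [simpleCoeff_sub]
      omega
  · rw [seriesCoeff_of_notMem _ hv, seriesCoeff_of_notMem _ hv,
      seriesCoeff_of_notMem _ (sub_root_notMem_positiveCone hij hv)]
    simp

theorem seriesCoeff_prod_mul (a : RatFunc ℚ) {P : Finset (Fin (n + 1) × Fin (n + 1))}
    (hP : ∀ p ∈ P, p.1 < p.2) (φ : MvPowerSeries (Fin n) (RatFunc ℚ)) :
    seriesCoeff ((∏ p ∈ P, (1 - MvPowerSeries.C a * formalExp (root p.1 p.2))) * φ) =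
      convAction (RatFunc ℚ) _ (rootProd a P) (seriesCoeff φ) := by
  induction P using Finset.induction_on generalizing φ with
  | empty => simp [rootProd]
  | insert p P hp ih =>
    rw [rootProd, factorProd_insert hp, convAction_mul_apply,
      show convAction (RatFunc ℚ) _ (1 - AddMonoidAlgebra.single (root p.1 p.2) a)
        (seriesCoeff φ) = seriesCoeff ((1 - MvPowerSeries.C a * formalExp (root p.1 p.2)) * φ)
        from funext fun v => by
          rw [convAction_one_sub_single, seriesCoeff_one_sub_mul a (hP p (by simp))],
      ← rootProd, ← ih fun q hq => hP q (by simp [hq]), Finset.prod_insert hp]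
    congr 1
    ring

theorem constantCoeff_formalExp_root {i j : Fin (n + 1)} (hij : i < j) :
    MvPowerSeries.constantCoeff (formalExp (root i j)) = 0 := by
  classical
  rw [formalExp, ← MvPowerSeries.coeff_zero_eq_constantCoeff_apply, MvPowerSeries.coeff_monomial,
    if_neg]
  intro h
  refine root_ne_zero hij (eq_zero_of_simpleCoeff_eq_zero fun k => ?_)
  have h1 := DFunLike.congr_fun h k
  have h2 := root_mem_positiveCone hij k
  simp only [Finsupp.equivFunOnFinite_symm_apply_apply, Finsupp.coe_zero, Pi.zero_apply] at h1
  omega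

theorem formalKernelCoeff_eq_seriesCoeff :
    formalKernelCoeff = seriesCoeff (formalKernel n) := by
  funext v
  by_cases hv : v ∈ positiveCone n
  · rw [seriesCoeff_of_mem _ hv]
    exact if_pos hv
  · rw [seriesCoeff_of_notMem _ hv]
    exact if_neg hv

theorem isKernelCoeff_formalKernelCoeff :
    IsKernelCoeff RatFunc.X (formalKernelCoeff (n := n)) := by
  have hP : ∀ p ∈ posPairs n, p.1 < p.2 := fun p hp => (Finset.mem_filter.1 hp).2
  rw [formalKernelCoeff_eq_seriesCoeff]
  refine ⟨fun v hv => seriesCoeff_of_notMem _ hv, ?_⟩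
  rw [← seriesCoeff_one, ← seriesCoeff_prod_mul _ hP, ← seriesCoeff_prod_mul _ hP]
  congr 1
  rw [formalKernel, ← Finset.prod_mul_distrib, mul_one]
  refine Finset.prod_congr rfl fun p hp => ?_
  rw [mul_left_comm, MvPowerSeries.mul_inv_cancel, map_one, one_mul, mul_one]
  simp [constantCoeff_formalExp_root (hP p hp)]

theorem formalPairing_one_latticeExp (v : rootLattice n) :
    formalPairing 1 (latticeExp (RatFunc ℚ) v) = formalKernelCoeff v := by
  simp [formalPairing, bar, latticeExp, AddMonoidAlgebra.mapDomain_single]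

end Formal

theorem mainTheorem4 (n : ℕ) (hn : 1 ≤ n) (v : rootLattice n) (hv : IsFirstLayer v) :
    (∀ t : ℂ, 0 < ‖t‖ → ‖t‖ < 1 →
      cherednikPairing t 1 (latticeExp ℂ v) = t ^ height v * oneSubPow t (aggregate v)) ∧
    formalPairing 1 (latticeExp (RatFunc ℚ) v) =
      (RatFunc.X : RatFunc ℚ) ^ height v * oneSubPow RatFunc.X (aggregate v) := by
  refine ⟨fun t ht0 ht1 => ?_, ?_⟩
  · rw [cherednikPairing_one_latticeExp, oneSubPow_aggregate]
    exact (isKernelCoeff_torusCoeff ht1).eq_coeffFormula (norm_pos_iff.1 ht0) hv.neg_one_le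
  · rw [formalPairing_one_latticeExp, oneSubPow_aggregate]
    exact isKernelCoeff_formalKernelCoeff.eq_coeffFormula RatFunc.X_ne_zero hv.neg_one_le
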